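/- A $k$-uniform hypergraph $H=(V,E)$ consists of a finite vertex set $V$ and a set $E$ of $k$-element subsets of $V$. A (linear) embedding of $H$ into $\mathbb{R}^d$ is a map $\phi:V\to\mathbb{R}^d$ such that $\dim\operatorname{aff}\phi(e)=k-1$ for every $e\in E$ and $\operatorname{conv}\phi(e_1\cap e_2)=\operatorname{conv}\phi(e_1)\cap\operatorname{conv}\phi(e_2)$ for all $e_1,e_2\in E$; if such a map exists, $H$ is called $d$-embeddable. The weak chromatic number $\chi^{\mathsf w}(H)$ is the least $c$ for which there is a map $\kappa:V\to\{1,\dots,c\}$ with $|\kappa(e)|>1$ for every $e\in E$. Let $$\chi^{\mathsf w}_{d,k}(n)=\max\{\chi^{\mathsf w}(H): H \text{ is a } d\text{-embeddable } k\text{-uniform hypergraph with } n \text{ vertices}\}.$$ **Theorem.** As $n\to\infty$, $$\chi^{\mathsf w}_{3,3}(n)=\Omega\!\left(\frac{\log n}{\log\log n}\right),$$ i.e. there are a constant $C>0$ and an $n_0$ such that $\chi^{\mathsf w}_{3,3}(n)\ge C\,\frac{\log n}{\log\log n}$ for all $n\ge n_0$. -/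

import Mathlib

open Filter

namespace Hypergraph

/-- `H` is a `k`-uniform hypergraph: the vertex set is finite and every edge has exactly
`k` elements. -/
def IsUniform {α : Type*} (H : Hypergraph α) (k : ℕ) : Prop :=
  H.vertexSet.Finite ∧ ∀ e ∈ H.edgeSet, e.ncard = k

/-- `κ`, restricted to the vertices of `H`, is a weak `c`-coloring: its colors lie in
`{1, …, c}` and every edge receives more than one color. -/
def IsWeakColoring {α : Type*} (H : Hypergraph α) (c : ℕ) (κ : α → ℕ) : Prop :=
  (∀ v ∈ H.vertexSet, κ v ∈ Set.Icc 1 c) ∧ ∀ e ∈ H.edgeSet, 1 < (κ '' e).ncard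

/-- The weak chromatic number: the least `c` for which a weak `c`-coloring exists. -/
noncomputable def weakChromaticNumber {α : Type*} (H : Hypergraph α) : ℕ :=
  sInf {c : ℕ | ∃ κ : α → ℕ, H.IsWeakColoring c κ}

/-- `φ`, restricted to the vertices of the `k`-uniform hypergraph `H`, is a (linear) embedding of
`H` into `ℝ^d`: the affine hull of every embedded edge has dimension `k - 1`, and two embedded
edges meet exactly in the convex hull of their common vertices. -/
def IsEmbedding {α : Type*} (H : Hypergraph α) (k d : ℕ)
    (φ : α → EuclideanSpace ℝ (Fin d)) : Prop :=
  (∀ e ∈ H.edgeSet, Module.finrank ℝ (affineSpan ℝ (φ '' e)).direction = k - 1) ∧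
  ∀ e₁ ∈ H.edgeSet, ∀ e₂ ∈ H.edgeSet,
    convexHull ℝ (φ '' (e₁ ∩ e₂)) = convexHull ℝ (φ '' e₁) ∩ convexHull ℝ (φ '' e₂)

/-- `H` is a `d`-embeddable `k`-uniform hypergraph. -/
def IsEmbeddable {α : Type*} (H : Hypergraph α) (d k : ℕ) : Prop :=
  H.IsUniform k ∧ ∃ φ : α → EuclideanSpace ℝ (Fin d), H.IsEmbedding k d φ

/-- The weak chromatic numbers of all `d`-embeddable `k`-uniform hypergraphs on `n` vertices. -/
def weakChromaticNumbers (d k n : ℕ) : Set ℕ :=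
  {c : ℕ | ∃ (α : Type) (H : Hypergraph α),
    H.IsEmbeddable d k ∧ H.vertexSet.ncard = n ∧ H.weakChromaticNumber = c}

/-- The maximum weak chromatic number of a `d`-embeddable `k`-uniform hypergraph on `n`
vertices. For `k ≥ 2` it is a genuine maximum, see `isGreatest_maxWeakChromaticNumber`. -/
noncomputable def maxWeakChromaticNumber (d k n : ℕ) : ℕ :=
  sSup (weakChromaticNumbers d k n)

/-- Coloring all vertices differently is a weak coloring if `k ≥ 2`. -/
theorem exists_isWeakColoring {α : Type*} (H : Hypergraph α) {k : ℕ} (hk : 2 ≤ k)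
    (hH : H.IsUniform k) : ∃ κ : α → ℕ, H.IsWeakColoring H.vertexSet.ncard κ := by
  classical
  obtain ⟨hfin, hunif⟩ := hH
  have : Fintype H.vertexSet := hfin.fintype
  have hc : Fintype.card H.vertexSet = H.vertexSet.ncard := by
    rw [← Nat.card_eq_fintype_card, Nat.card_coe_set_eq]
  let f := Fintype.equivFin H.vertexSet
  refine ⟨fun v => if h : v ∈ H.vertexSet then (f ⟨v, h⟩ : ℕ) + 1 else 0, ?_, ?_⟩
  · intro v hv
    have := (f ⟨v, hv⟩).isLt
    simp only [hv, dite_true, Set.mem_Icc]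
    omega
  · intro e he
    rw [Set.InjOn.ncard_image, hunif e he]
    · omega
    · intro x hx y hy hxy
      have hx' := H.subset_vertexSet_of_mem_edgeSet' he hx
      have hy' := H.subset_vertexSet_of_mem_edgeSet' he hy
      simp only [hx', hy', dite_true, add_left_inj, Fin.val_inj] at hxy
      simpa using f.injective hxy

/-- For `k ≥ 2` the weak chromatic number is attained by a weak coloring. -/
theorem isLeast_weakChromaticNumber {α : Type*} (H : Hypergraph α) {k : ℕ} (hk : 2 ≤ k)
    (hH : H.IsUniform k) :
    IsLeast {c : ℕ | ∃ κ : α → ℕ, H.IsWeakColoring c κ} H.weakChromaticNumber :=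
  ⟨Nat.sInf_mem ⟨_, H.exists_isWeakColoring hk hH⟩, fun _ hc => Nat.sInf_le hc⟩

theorem bddAbove_weakChromaticNumbers {d k n : ℕ} (hk : 2 ≤ k) :
    BddAbove (weakChromaticNumbers d k n) := by
  refine ⟨n, ?_⟩
  rintro c ⟨α, H, hH, rfl, rfl⟩
  exact Nat.sInf_le (H.exists_isWeakColoring hk hH.1)

theorem weakChromaticNumbers_nonempty (d k n : ℕ) : (weakChromaticNumbers d k n).Nonempty := by
  refine ⟨_, Fin n, ⟨Set.univ, ∅, by simp⟩, ⟨⟨Set.finite_univ, by simp⟩, 0, by simp, by simp⟩,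
    by simp [Set.ncard_univ], rfl⟩

/-- For `k ≥ 2` the maximum in the definition of `maxWeakChromaticNumber` exists. -/
theorem isGreatest_maxWeakChromaticNumber (d : ℕ) {k : ℕ} (hk : 2 ≤ k) (n : ℕ) :
    IsGreatest (weakChromaticNumbers d k n) (maxWeakChromaticNumber d k n) :=
  ⟨Nat.sSup_mem (weakChromaticNumbers_nonempty d k n) (bddAbove_weakChromaticNumbers hk),
    fun _ hc => le_csSup (bddAbove_weakChromaticNumbers hk) hc⟩

end Hypergraph

/-! Place the vertices on the moment curve in order. An affine dependence between its points is
orthogonal to all cubics, so its signs change at least four times. Two triangles can therefore meet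
improperly only if three vertices of one alternate with two of the other, `a < p < b < q < c`. This
makes embeddability in `ℝ³` the order condition `IsNoncrossing` (`convexHull_momentCurve_inter`).

Such triples forcing many colors are built recursively (`bookRel`). Take `k + 1` spine vertices, and
for each pair of them a copy of the previous construction, every vertex of which forms a triple with
that pair. With at most `k` colors some pair is monochromatic; then either its copy repeats that
color, or the copy uses fewer than `k` colors and induction applies. The size grows by a factor of
at most `(2(k+1))²` per step, so `(2k)^(2k)` vertices suffice, and solving for `k` gives order `log
n / log log n`. -/

/-! ### Noncrossing triples that force many colors -/

/-- A ternary relation on `ℕ`, read as a set of increasing triples below `n`, no triple of which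
is separated at its middle vertex by two vertices of another triple. -/
structure IsNoncrossing (n : ℕ) (E : ℕ → ℕ → ℕ → Prop) : Prop where
  lt₁₂ : ∀ {a b c}, E a b c → a < b
  lt₂₃ : ∀ {a b c}, E a b c → b < c
  lt : ∀ {a b c}, E a b c → c < n
  not_separated : ∀ {a b c a' b' c'}, E a b c → E a' b' c' →
    ∀ p ∈ ({a', b', c'} : Set ℕ), ∀ q ∈ ({a', b', c'} : Set ℕ), ¬ (a < p ∧ p < b ∧ b < q ∧ q < c)

/-- Every coloring of `{0, …, n - 1}` by fewer than `k` colors has a monochromatic triple. -/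
def ForcesColors (n k : ℕ) (E : ℕ → ℕ → ℕ → Prop) : Prop :=
  ∀ (P : Finset ℕ) (κ : ℕ → ℕ), P.card < k → (∀ v < n, κ v ∈ P) →
    ∃ a b c, E a b c ∧ κ a = κ b ∧ κ b = κ c

/-- Position `j * (1 + m * n)` holds a spine vertex; it is followed by `m` blocks of length `n`. The
`i`-th of the blocks after the `j`-th spine vertex carries, for `i < j`, a copy of `E`, all of whose
vertices are joined to the pair of the `i`-th and the `j`-th spine vertex. -/
def bookRel (m n : ℕ) (E : ℕ → ℕ → ℕ → Prop) (a b c : ℕ) : Prop :=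
  ∃ i j, i < j ∧ j < m ∧
    ((a = i * (1 + m * n) ∧ b = j * (1 + m * n) ∧
        ∃ v < n, c = j * (1 + m * n) + 1 + i * n + v) ∨
      ∃ x y z, E x y z ∧ a = j * (1 + m * n) + 1 + i * n + x ∧
        b = j * (1 + m * n) + 1 + i * n + y ∧ c = j * (1 + m * n) + 1 + i * n + z)

/-- The blocks after a spine vertex `j` are ordered by `i`, and this order prevents crossings. To
separate `(i, j, c)`, a triple needs a vertex `q` between `j` and `c` and a vertex `p` between `i`
and `j`, so it must be a spine triple `(k, j, q)`: then `q < c` gives `k ≤ i`, while `p` being the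
`k`-th spine vertex gives `k > i`. A triple inside a block can only be separated by one with two
vertices in that block, hence by one of the same copy of `E`. -/
theorem IsNoncrossing.bookRel {m n : ℕ} {E : ℕ → ℕ → ℕ → Prop} (h : IsNoncrossing n E) :
    IsNoncrossing (m * (1 + m * n)) (bookRel m n E) := by
  have spine : ∀ {i j : ℕ}, i < j → i * (1 + m * n) + (1 + m * n) ≤ j * (1 + m * n) := by
    intro i j hij
    calc i * (1 + m * n) + (1 + m * n) = (i + 1) * (1 + m * n) := by ring
      _ ≤ _ := Nat.mul_le_mul_right _ hij
  have block : ∀ {i j : ℕ}, i < j → i * n + n ≤ j * n := by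
    intro i j hij
    calc i * n + n = (i + 1) * n := by ring
      _ ≤ _ := Nat.mul_le_mul_right _ hij
  refine ⟨?_, ?_, ?_, ?_⟩
  · rintro a b c ⟨i, j, hij, hj, ⟨rfl, rfl, v, hv, rfl⟩ | ⟨x, y, z, hE, rfl, rfl, rfl⟩⟩
    · have := spine hij
      omega
    · have := h.lt₁₂ hE
      omega
  · rintro a b c ⟨i, j, hij, hj, ⟨rfl, rfl, v, hv, rfl⟩ | ⟨x, y, z, hE, rfl, rfl, rfl⟩⟩
    · omega
    · have := h.lt₂₃ hE
      omega
  · rintro a b c ⟨i, j, hij, hj, ⟨rfl, rfl, v, hv, rfl⟩ | ⟨x, y, z, hE, rfl, rfl, rfl⟩⟩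
    · have := spine hj
      have := block (hij.trans hj)
      omega
    · have := spine hj
      have := block (hij.trans hj)
      have := h.lt hE
      omega
  · rintro a b c a' b' c' ⟨i, j, hij, hj, H⟩ ⟨k, l, hkl, hl, H'⟩ p hp q hq ⟨h₁, h₂, h₃, h₄⟩
    simp only [Set.mem_insert_iff, Set.mem_singleton_iff] at hp hq
    have b₁ := block (hij.trans hj)
    have b₂ := block (hkl.trans hl)
    have s₁ := spine hij
    have s₂ := spine hkl
    rcases H with ⟨rfl, rfl, v, hv, rfl⟩ | ⟨x, y, z, hE, rfl, rfl, rfl⟩ <;>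
    rcases H' with ⟨rfl, rfl, v', hv', rfl⟩ | ⟨x', y', z', hE', rfl, rfl, rfl⟩
    · rcases lt_trichotomy j l with hjl | rfl | hjl
      · have := spine hjl
        omega
      · rcases lt_trichotomy i k with hik | rfl | hik
        · have := spine hik
          have := block hik
          omega
        · omega
        · have := spine hik
          omega
      · have := spine hjl
        omega
    · have := h.lt₁₂ hE'
      have := h.lt₂₃ hE'
      have := h.lt hE'
      rcases lt_trichotomy j l with hjl | rfl | hjl
      · have := spine hjl
        omega
      · omega
      · have := spine hjl
        omega
    · have := h.lt₁₂ hE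
      have := h.lt₂₃ hE
      have := h.lt hE
      rcases lt_trichotomy j l with hjl | rfl | hjl
      · have := spine hjl
        omega
      · omega
      · have := spine hjl
        omega
    · have := h.lt₁₂ hE
      have := h.lt₂₃ hE
      have := h.lt hE
      have := h.lt₁₂ hE'
      have := h.lt₂₃ hE'
      have := h.lt hE'
      rcases lt_trichotomy j l with hjl | rfl | hjl
      · have := spine hjl
        omega
      · rcases lt_trichotomy i k with hik | rfl | hik
        · have := block hik
          omega
        · refine h.not_separated hE hE' (p - (j * (1 + m * n) + 1 + i * n)) ?_
            (q - (j * (1 + m * n) + 1 + i * n)) ?_ ⟨?_, ?_, ?_, ?_⟩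
          · simp only [Set.mem_insert_iff, Set.mem_singleton_iff]
            omega
          · simp only [Set.mem_insert_iff, Set.mem_singleton_iff]
            omega
          all_goals omega
        · have := block hik
          omega
      · have := spine hjl
        omega

theorem ForcesColors.bookRel {k n : ℕ} {E : ℕ → ℕ → ℕ → Prop} (h : ForcesColors n k E) :
    ForcesColors ((k + 1) * (1 + (k + 1) * n)) (k + 1) (bookRel (k + 1) n E) := by
  intro P κ hP hκ
  have spine : ∀ {i j : ℕ}, i < j →
      i * (1 + (k + 1) * n) + (1 + (k + 1) * n) ≤ j * (1 + (k + 1) * n) := by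
    intro i j hij
    calc _ = (i + 1) * (1 + (k + 1) * n) := by ring
      _ ≤ _ := Nat.mul_le_mul_right _ hij
  have block : ∀ {i : ℕ}, i < k + 1 → i * n + n ≤ (k + 1) * n := by
    intro i hi
    calc i * n + n = (i + 1) * n := by ring
      _ ≤ _ := Nat.mul_le_mul_right _ hi
  obtain ⟨i, j, hij, hj, hκij⟩ : ∃ i j, i < j ∧ j < k + 1 ∧
      κ (i * (1 + (k + 1) * n)) = κ (j * (1 + (k + 1) * n)) := by
    obtain ⟨i, hi, j, hj, hne, he⟩ := Finset.exists_ne_map_eq_of_card_lt_of_maps_to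
      (s := Finset.range (k + 1)) (t := P) (by simpa using hP)
      (f := fun i => κ (i * (1 + (k + 1) * n))) (fun i hi => by
        have hi := spine (Finset.mem_range.1 (Finset.mem_coe.1 hi))
        exact hκ _ (by omega))
    rw [Finset.mem_range] at hi hj
    rcases lt_or_gt_of_ne hne with hlt | hlt
    · exact ⟨i, j, hlt, hj, he⟩
    · exact ⟨j, i, hlt, hi, he.symm⟩
  have hs := spine hj
  have hb := block (hij.trans hj)
  by_cases hv : ∃ v < n, κ (j * (1 + (k + 1) * n) + 1 + i * n + v) = κ (j * (1 + (k + 1) * n))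
  · obtain ⟨v, hv, hvκ⟩ := hv
    exact ⟨_, _, _, ⟨i, j, hij, hj, Or.inl ⟨rfl, rfl, v, hv, rfl⟩⟩, hκij, hvκ.symm⟩
  · push Not at hv
    -- The block avoids the color shared by the two spine vertices, so that color can be removed
    -- from the palette.
    obtain ⟨x, y, z, hE, hxy, hyz⟩ := h (P.erase (κ (j * (1 + (k + 1) * n))))
      (fun v => κ (j * (1 + (k + 1) * n) + 1 + i * n + v))
      (by
        have hm : κ (j * (1 + (k + 1) * n)) ∈ P := hκ _ (by omega)
        have := Finset.card_pos.2 ⟨_, hm⟩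
        rw [Finset.card_erase_of_mem hm]
        omega)
      (fun v hvn => Finset.mem_erase.2 ⟨hv v hvn, hκ _ (by omega)⟩)
    exact ⟨_, _, _, ⟨i, j, hij, hj, Or.inr ⟨x, y, z, hE, rfl, rfl, rfl⟩⟩, hxy, hyz⟩

theorem exists_isNoncrossing_forcesColors (k : ℕ) :
    ∃ n ≤ (2 * k) ^ (2 * k), ∃ E, IsNoncrossing n E ∧ ForcesColors n k E := by
  -- Positivity of `n` is carried along because the size estimate `(k + 1) * (1 + (k + 1) * n) ≤ (2
  -- * (k + 1)) ^ 2 * n` fails at `n = 0`.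
  suffices ∃ n, 0 < n ∧ n ≤ (2 * k) ^ (2 * k) ∧ ∃ E, IsNoncrossing n E ∧ ForcesColors n k E by
    obtain ⟨n, -, h⟩ := this
    exact ⟨n, h⟩
  induction k with
  | zero =>
    exact ⟨1, one_pos, by simp, fun _ _ _ => False,
      ⟨False.elim, False.elim, False.elim, fun h => h.elim⟩,
      fun P κ hP => absurd hP (Nat.not_lt_zero _)⟩
  | succ k ih =>
    obtain ⟨n, hn, hle, E, hE, hE'⟩ := ih
    refine ⟨_, by positivity, ?_, bookRel (k + 1) n E, hE.bookRel, hE'.bookRel⟩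
    calc (k + 1) * (1 + (k + 1) * n) ≤ (2 * (k + 1)) ^ 2 * n := by nlinarith
      _ ≤ (2 * (k + 1)) ^ 2 * (2 * (k + 1)) ^ (2 * k) := by
        gcongr
        exact hle.trans (Nat.pow_le_pow_left (by omega) _)
      _ = _ := by ring

theorem Nat.exists_least {p : ℕ → Prop} (h : ∃ n, p n) : ∃ n, p n ∧ ∀ m < n, ¬ p m := by
  classical
  exact ⟨Nat.find h, Nat.find_spec h, fun _ => Nat.find_min h⟩

/-! ### Sign changes of sequences orthogonal to cubics -/

section Alternation

variable {s : Finset ℕ} {u : ℕ → ℝ}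

theorem not_cubic_mul_nonneg (h : ∀ k ≤ 3, ∑ i ∈ s, u i * (i : ℝ) ^ k = 0) (c₀ c₁ c₂ c₃ : ℝ) {t : ℕ}
    (ht : t ∈ s)
    (hpos : 0 < u t * (c₀ + c₁ * (t : ℝ) + c₂ * (t : ℝ) ^ 2 + c₃ * (t : ℝ) ^ 3)) :
    ¬ ∀ i ∈ s, 0 ≤ u i * (c₀ + c₁ * (i : ℝ) + c₂ * (i : ℝ) ^ 2 + c₃ * (i : ℝ) ^ 3) := by
  intro hnn
  have hsum := Finset.sum_pos' hnn ⟨t, ht, hpos⟩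
  have : ∑ i ∈ s, u i * (c₀ + c₁ * (i : ℝ) + c₂ * (i : ℝ) ^ 2 + c₃ * (i : ℝ) ^ 3) =
      c₀ * ∑ i ∈ s, u i * (i : ℝ) ^ 0 + c₁ * ∑ i ∈ s, u i * (i : ℝ) ^ 1 +
      c₂ * ∑ i ∈ s, u i * (i : ℝ) ^ 2 + c₃ * ∑ i ∈ s, u i * (i : ℝ) ^ 3 := by
    simp only [Finset.mul_sum, ← Finset.sum_add_distrib]
    exact Finset.sum_congr rfl fun i _ => by ring
  rw [this, h 0 (by norm_num), h 1 (by norm_num), h 2 (by norm_num), h 3 le_rfl] at hsum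
  simp at hsum

/-- Choose each `t` as the first place where the required next sign occurs. If the pattern stopped
early, the polynomial with simple roots at `t₂`, `t₃`, … found so far would have degree at most
three and agree in sign with `u` everywhere, strictly at `t₁`, contradicting orthogonality. -/
theorem exists_alternating_of_first_pos (h : ∀ k ≤ 3, ∑ i ∈ s, u i * (i : ℝ) ^ k = 0) {t₁ : ℕ}
    (h₁ : t₁ ∈ s) (hu₁ : 0 < u t₁) (hmin : ∀ i ∈ s, i < t₁ → u i = 0) :
    ∃ t₂ ∈ s, ∃ t₃ ∈ s, ∃ t₄ ∈ s, ∃ t₅ ∈ s, t₁ < t₂ ∧ t₂ < t₃ ∧ t₃ < t₄ ∧ t₄ < t₅ ∧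
      u t₂ < 0 ∧ 0 < u t₃ ∧ u t₄ < 0 ∧ 0 < u t₅ := by
  have cast_sub : ∀ {i j : ℕ}, i ≤ j → (0 : ℝ) ≤ j - i := fun hij => by
    rw [sub_nonneg]
    exact_mod_cast hij
  have cast_sub_pos : ∀ {i j : ℕ}, i < j → (0 : ℝ) < j - i := fun hij => by
    rw [sub_pos]
    exact_mod_cast hij
  have ex₂ : ∃ t, t ∈ s ∧ t₁ < t ∧ u t < 0 := by
    by_contra! hne
    refine not_cubic_mul_nonneg h 1 0 0 0 h₁ (by simpa using hu₁) fun i hi => ?_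
    rcases lt_trichotomy i t₁ with hlt | rfl | hlt
    · simp [hmin i hi hlt]
    · simpa using hu₁.le
    · simpa using hne i hi hlt
  obtain ⟨t₂, ⟨h₂, h₁₂, hu₂⟩, hmin₂⟩ := Nat.exists_least ex₂
  have nn₂ : ∀ i ∈ s, i < t₂ → 0 ≤ u i := fun i hi hlt => by
    rcases lt_trichotomy i t₁ with h' | rfl | h'
    · exact (hmin i hi h').ge
    · exact hu₁.le
    · exact not_lt.1 fun hneg => hmin₂ i hlt ⟨hi, h', hneg⟩
  have ex₃ : ∃ t, t ∈ s ∧ t₂ < t ∧ 0 < u t := by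
    by_contra! hne
    have key : ∀ i : ℕ, (t₂ : ℝ) + (-1) * (i : ℝ) + 0 * (i : ℝ) ^ 2 + 0 * (i : ℝ) ^ 3 = t₂ - i :=
      fun i => by ring
    refine not_cubic_mul_nonneg h t₂ (-1) 0 0 h₁ ?_ fun i hi => ?_ <;> rw [key]
    · exact mul_pos hu₁ (cast_sub_pos h₁₂)
    · rcases lt_or_ge i t₂ with hlt | hle
      · exact mul_nonneg (nn₂ i hi hlt) (cast_sub hlt.le)
      · rcases hle.eq_or_lt with rfl | hlt
        · simp
        · exact mul_nonneg_of_nonpos_of_nonpos (hne i hi hlt) (by linarith [cast_sub hlt.le])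
  obtain ⟨t₃, ⟨h₃, h₂₃, hu₃⟩, hmin₃⟩ := Nat.exists_least ex₃
  have np₃ : ∀ i ∈ s, t₂ ≤ i → i < t₃ → u i ≤ 0 := fun i hi hle hlt => by
    rcases hle.eq_or_lt with rfl | h'
    · exact hu₂.le
    · exact not_lt.1 fun hneg => hmin₃ i hlt ⟨hi, h', hneg⟩
  have ex₄ : ∃ t, t ∈ s ∧ t₃ < t ∧ u t < 0 := by
    by_contra! hne
    have key : ∀ i : ℕ, (t₂ : ℝ) * t₃ + (-(t₂ + t₃)) * (i : ℝ) + 1 * (i : ℝ) ^ 2 + 0 * (i : ℝ) ^ 3 =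
      (t₂ - i) * (t₃ - i) := fun i => by ring
    refine not_cubic_mul_nonneg h (t₂ * t₃) (-(t₂ + t₃)) 1 0 h₁ ?_ fun i hi => ?_ <;> rw [key]
    · exact mul_pos hu₁ (mul_pos (cast_sub_pos h₁₂) (cast_sub_pos (h₁₂.trans h₂₃)))
    · rcases lt_or_ge i t₂ with hlt | hle
      · exact mul_nonneg (nn₂ i hi hlt) (mul_nonneg (cast_sub hlt.le) (cast_sub (hlt.trans h₂₃).le))
      rcases lt_or_ge i t₃ with hlt | hle'
      · exact mul_nonneg_of_nonpos_of_nonpos (np₃ i hi hle hlt)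
          (mul_nonpos_of_nonpos_of_nonneg (by linarith [cast_sub hle]) (cast_sub hlt.le))
      · refine mul_nonneg ?_ (mul_nonneg_of_nonpos_of_nonpos (by linarith [cast_sub hle])
          (by linarith [cast_sub hle']))
        rcases hle'.eq_or_lt with rfl | hlt
        · exact hu₃.le
        · exact hne i hi hlt
  obtain ⟨t₄, ⟨h₄, h₃₄, hu₄⟩, hmin₄⟩ := Nat.exists_least ex₄
  have nn₄ : ∀ i ∈ s, t₃ ≤ i → i < t₄ → 0 ≤ u i := fun i hi hle hlt => by
    rcases hle.eq_or_lt with rfl | h'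
    · exact hu₃.le
    · exact not_lt.1 fun hneg => hmin₄ i hlt ⟨hi, h', hneg⟩
  have ex₅ : ∃ t, t ∈ s ∧ t₄ < t ∧ 0 < u t := by
    by_contra! hne
    have key : ∀ i : ℕ, (t₂ : ℝ) * t₃ * t₄ + (-(t₂ * t₃ + t₂ * t₄ + t₃ * t₄)) * (i : ℝ) +
        (t₂ + t₃ + t₄) * (i : ℝ) ^ 2 + (-1) * (i : ℝ) ^ 3 =
      (t₂ - i) * (t₃ - i) * (t₄ - i) := fun i => by ring
    refine not_cubic_mul_nonneg h (t₂ * t₃ * t₄) (-(t₂ * t₃ + t₂ * t₄ + t₃ * t₄))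
      (t₂ + t₃ + t₄) (-1) h₁ ?_ fun i hi => ?_ <;> rw [key]
    · exact mul_pos hu₁ (mul_pos (mul_pos (cast_sub_pos h₁₂) (cast_sub_pos (h₁₂.trans h₂₃)))
        (cast_sub_pos ((h₁₂.trans h₂₃).trans h₃₄)))
    · rcases lt_or_ge i t₂ with hlt | hle
      · exact mul_nonneg (nn₂ i hi hlt) (mul_nonneg (mul_nonneg (cast_sub hlt.le)
          (cast_sub (hlt.trans h₂₃).le)) (cast_sub ((hlt.trans h₂₃).trans h₃₄).le))
      have n₂ : (t₂ : ℝ) - i ≤ 0 := by linarith [cast_sub hle]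
      rcases lt_or_ge i t₃ with hlt | hle'
      · exact mul_nonneg_of_nonpos_of_nonpos (np₃ i hi hle hlt) (mul_nonpos_of_nonpos_of_nonneg
          (mul_nonpos_of_nonpos_of_nonneg n₂ (cast_sub hlt.le)) (cast_sub (hlt.trans h₃₄).le))
      have n₃ : (t₃ : ℝ) - i ≤ 0 := by linarith [cast_sub hle']
      rcases lt_or_ge i t₄ with hlt | hle''
      · exact mul_nonneg (nn₄ i hi hle' hlt)
          (mul_nonneg (mul_nonneg_of_nonpos_of_nonpos n₂ n₃) (cast_sub hlt.le))
      · refine mul_nonneg_of_nonpos_of_nonpos ?_ (mul_nonpos_of_nonneg_of_nonpos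
          (mul_nonneg_of_nonpos_of_nonpos n₂ n₃) (by linarith [cast_sub hle'']))
        rcases hle''.eq_or_lt with rfl | hlt
        · exact hu₄.le
        · exact hne i hi hlt
  obtain ⟨t₅, h₅, h₄₅, hu₅⟩ := ex₅
  exact ⟨t₂, h₂, t₃, h₃, t₄, h₄, t₅, h₅, h₁₂, h₂₃, h₃₄, h₄₅, hu₂, hu₃, hu₄, hu₅⟩

/-- Five points with alternating signs witness an affine dependence on the moment curve in `ℝ³`. -/
theorem exists_alternating (h : ∀ k ≤ 3, ∑ i ∈ s, u i * (i : ℝ) ^ k = 0)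
    (hu : ∃ i ∈ s, u i ≠ 0) :
    ∃ t₁ ∈ s, ∃ t₂ ∈ s, ∃ t₃ ∈ s, ∃ t₄ ∈ s, ∃ t₅ ∈ s, t₁ < t₂ ∧ t₂ < t₃ ∧ t₃ < t₄ ∧ t₄ < t₅ ∧
      (0 < u t₁ ∧ u t₂ < 0 ∧ 0 < u t₃ ∧ u t₄ < 0 ∧ 0 < u t₅ ∨
        u t₁ < 0 ∧ 0 < u t₂ ∧ u t₃ < 0 ∧ 0 < u t₄ ∧ u t₅ < 0) := by
  obtain ⟨t₁, ⟨h₁, hu₁⟩, hmin⟩ := Nat.exists_least hu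
  have hmin' : ∀ i ∈ s, i < t₁ → u i = 0 := fun i hi hlt => by
    by_contra hne
    exact hmin i hlt ⟨hi, hne⟩
  rcases lt_or_gt_of_ne hu₁ with hneg | hpos
  · obtain ⟨t₂, h₂, t₃, h₃, t₄, h₄, t₅, h₅, h₁₂, h₂₃, h₃₄, h₄₅, hu⟩ :=
      exists_alternating_of_first_pos (s := s) (u := fun i => - u i) (t₁ := t₁)
        (fun k hk => by simpa using h k hk) h₁ (by simpa using hneg)
        (fun i hi hlt => by simpa using hmin' i hi hlt)
    simp only [Left.neg_neg_iff, Left.neg_pos_iff] at hu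
    exact ⟨t₁, h₁, t₂, h₂, t₃, h₃, t₄, h₄, t₅, h₅, h₁₂, h₂₃, h₃₄, h₄₅, Or.inr ⟨hneg, hu⟩⟩
  · obtain ⟨t₂, h₂, t₃, h₃, t₄, h₄, t₅, h₅, h₁₂, h₂₃, h₃₄, h₄₅, hu⟩ :=
      exists_alternating_of_first_pos h h₁ hpos hmin'
    exact ⟨t₁, h₁, t₂, h₂, t₃, h₃, t₄, h₄, t₅, h₅, h₁₂, h₂₃, h₃₄, h₄₅, Or.inl ⟨hpos, hu⟩⟩

end Alternation

/-! ### Triangles on the moment curve -/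

/-- The moment curve in `ℝ³` at the natural numbers. -/
noncomputable def momentCurve (n : ℕ) : EuclideanSpace ℝ (Fin 3) :=
  !₂[(n : ℝ), (n : ℝ) ^ 2, (n : ℝ) ^ 3]

theorem momentCurve_injective : Function.Injective momentCurve := by
  intro m n h
  have := congrArg (fun x : EuclideanSpace ℝ (Fin 3) => x 0) h
  simpa [momentCurve] using this

theorem sum_mul_pow_eq_zero {s : Finset ℕ} {u : ℕ → ℝ} (h₀ : ∑ i ∈ s, u i = 0)
    (h : ∑ i ∈ s, u i • momentCurve i = 0) : ∀ k ≤ 3, ∑ i ∈ s, u i * (i : ℝ) ^ k = 0 := by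
  have coord : ∀ l : Fin 3, ∑ i ∈ s, u i * (momentCurve i) l = 0 := fun l => by
    have := congrArg (fun x : EuclideanSpace ℝ (Fin 3) => x l) h
    simpa using this
  intro k hk
  interval_cases k
  · simpa using h₀
  · simpa [momentCurve] using coord 0
  · simpa [momentCurve] using coord 1
  · simpa [momentCurve] using coord 2

theorem exists_weights_of_mem_convexHull {s : Finset ℕ} {x : EuclideanSpace ℝ (Fin 3)}
    (hx : x ∈ convexHull ℝ (momentCurve '' s)) :
    ∃ w : ℕ → ℝ, (∀ i, 0 ≤ w i) ∧ (∀ i ∉ s, w i = 0) ∧ ∑ i ∈ s, w i = 1 ∧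
      ∑ i ∈ s, w i • momentCurve i = x := by
  classical
  rw [← Finset.coe_image, Finset.mem_convexHull'] at hx
  obtain ⟨w, hw, hw₁, hwx⟩ := hx
  rw [Finset.sum_image momentCurve_injective.injOn] at hw₁ hwx
  -- Extending the weights by zero lets combinations over different vertex sets be subtracted.
  refine ⟨fun i => if i ∈ s then w (momentCurve i) else 0, fun i => ?_, fun i hi => if_neg hi, ?_, ?_⟩
  · dsimp only
    split_ifs with hi
    · exact hw _ (Finset.mem_image_of_mem _ hi)
    · exact le_rfl
  · rw [← hw₁]
    exact Finset.sum_congr rfl fun i hi => if_pos hi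
  · rw [← hwx]
    exact Finset.sum_congr rfl fun i hi => by simp only [if_pos hi]

/-- Two representations of a common point differ by an affine dependence `w - v`, positive only on
`s` and negative only on `t`. If nonzero, it alternates at five points, which the hypotheses
exclude. So `w = v` is supported on `s ∩ t`. -/
theorem convexHull_momentCurve_inter {s t : Finset ℕ}
    (hst : ∀ a ∈ s, ∀ b ∈ s, ∀ c ∈ s, ∀ p ∈ t, ∀ q ∈ t, ¬ (a < p ∧ p < b ∧ b < q ∧ q < c))
    (hts : ∀ a ∈ t, ∀ b ∈ t, ∀ c ∈ t, ∀ p ∈ s, ∀ q ∈ s, ¬ (a < p ∧ p < b ∧ b < q ∧ q < c)) :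
    convexHull ℝ (momentCurve '' (s ∩ t : Set ℕ)) =
      convexHull ℝ (momentCurve '' s) ∩ convexHull ℝ (momentCurve '' t) := by
  classical
  refine (Set.subset_inter (convexHull_mono (Set.image_mono Set.inter_subset_left))
    (convexHull_mono (Set.image_mono Set.inter_subset_right))).antisymm ?_
  rintro x ⟨hxs, hxt⟩
  obtain ⟨w, hw, hws, hw₁, hwx⟩ := exists_weights_of_mem_convexHull hxs
  obtain ⟨v, hv, hvt, hv₁, hvx⟩ := exists_weights_of_mem_convexHull hxt
  have mem_s : ∀ i, 0 < w i - v i → i ∈ s := fun i hi => by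
    by_contra his
    linarith [hws i his, hv i]
  have mem_t : ∀ i, w i - v i < 0 → i ∈ t := fun i hi => by
    by_contra hit
    linarith [hvt i hit, hw i]
  have eq : ∀ i ∈ s ∪ t, w i = v i := by
    have e₁ : ∑ i ∈ s ∪ t, w i = ∑ i ∈ s, w i :=
      (Finset.sum_subset Finset.subset_union_left fun i _ hi => hws i hi).symm
    have e₂ : ∑ i ∈ s ∪ t, v i = ∑ i ∈ t, v i :=
      (Finset.sum_subset Finset.subset_union_right fun i _ hi => hvt i hi).symm
    have e₃ : ∑ i ∈ s ∪ t, w i • momentCurve i = ∑ i ∈ s, w i • momentCurve i :=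
      (Finset.sum_subset Finset.subset_union_left fun i _ hi => by rw [hws i hi, zero_smul]).symm
    have e₄ : ∑ i ∈ s ∪ t, v i • momentCurve i = ∑ i ∈ t, v i • momentCurve i :=
      (Finset.sum_subset Finset.subset_union_right fun i _ hi => by rw [hvt i hi, zero_smul]).symm
    by_contra! hne
    obtain ⟨i, hi, hne⟩ := hne
    obtain ⟨t₁, -, t₂, -, t₃, -, t₄, -, t₅, -, h₁₂, h₂₃, h₃₄, h₄₅, H⟩ :=
      exists_alternating (s := s ∪ t) (u := fun i => w i - v i)
        (sum_mul_pow_eq_zero (by rw [Finset.sum_sub_distrib, e₁, e₂, hw₁, hv₁, sub_self])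
          (by simp only [sub_smul]; rw [Finset.sum_sub_distrib, e₃, e₄, hwx, hvx, sub_self]))
        ⟨i, hi, sub_ne_zero.2 hne⟩
    rcases H with ⟨h₁, h₂, h₃, h₄, h₅⟩ | ⟨h₁, h₂, h₃, h₄, h₅⟩
    · exact hst _ (mem_s _ h₁) _ (mem_s _ h₃) _ (mem_s _ h₅) _ (mem_t _ h₂) _ (mem_t _ h₄)
        ⟨h₁₂, h₂₃, h₃₄, h₄₅⟩
    · exact hts _ (mem_t _ h₁) _ (mem_t _ h₃) _ (mem_t _ h₅) _ (mem_s _ h₂) _ (mem_s _ h₄)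
        ⟨h₁₂, h₂₃, h₃₄, h₄₅⟩
  have hw0 : ∀ i ∈ s, i ∉ s ∩ t → w i = 0 := fun i his hi => by
    rw [eq i (Finset.mem_union_left _ his)]
    exact hvt i fun hit => hi (Finset.mem_inter.2 ⟨his, hit⟩)
  rw [← Finset.sum_subset Finset.inter_subset_left hw0] at hw₁
  rw [← Finset.sum_subset Finset.inter_subset_left fun i his hi => by
    rw [hw0 i his hi, zero_smul]] at hwx
  rw [← hwx]
  refine (convex_convexHull ℝ _).sum_mem (fun i _ => hw i) hw₁ fun i hi =>
    subset_convexHull ℝ _ (Set.mem_image_of_mem _ ?_)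
  exact_mod_cast hi

theorem finrank_direction_affineSpan_momentCurve {a b c : ℕ} (hab : a < b) (hbc : b < c) :
    Module.finrank ℝ (affineSpan ℝ (momentCurve '' {a, b, c})).direction = 2 := by
  have hind : AffineIndependent ℝ ![momentCurve a, momentCurve b, momentCurve c] := by
    rw [affineIndependent_iff_not_collinear_set,
      collinear_iff_of_mem (p₀ := momentCurve a) (Set.mem_insert _ _)]
    rintro ⟨v, hv⟩
    obtain ⟨r, hr⟩ := hv (momentCurve b) (by simp)
    obtain ⟨r', hr'⟩ := hv (momentCurve c) (by simp)
    have e₁ := congrArg (fun x : EuclideanSpace ℝ (Fin 3) => x 0) hr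
    have e₂ := congrArg (fun x : EuclideanSpace ℝ (Fin 3) => x 1) hr
    have e₃ := congrArg (fun x : EuclideanSpace ℝ (Fin 3) => x 0) hr'
    have e₄ := congrArg (fun x : EuclideanSpace ℝ (Fin 3) => x 1) hr'
    simp only [momentCurve, vadd_eq_add, PiLp.add_apply, PiLp.smul_apply, smul_eq_mul,
      PiLp.toLp_apply, Matrix.cons_val_zero, Matrix.cons_val_one] at e₁ e₂ e₃ e₄
    have hab' : (a : ℝ) < b := by exact_mod_cast hab
    have hbc' : (b : ℝ) < c := by exact_mod_cast hbc
    -- Collinearity of the projections to the first two coordinates makes their Vandermonde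
    -- determinant vanish.
    have key : ((b : ℝ) - a) * (c - a) * (c - b) = 0 := by
      linear_combination (c ^ 2 - a ^ 2 : ℝ) * e₁ + (r * v 0) * e₄ - (c - a : ℝ) * e₂ -
        (r * v 1) * e₃
    have : 0 < ((b : ℝ) - a) * (c - a) * (c - b) :=
      mul_pos (mul_pos (by linarith) (by linarith)) (by linarith)
    linarith
  have himage : momentCurve '' {a, b, c} =
      Set.range ![momentCurve a, momentCurve b, momentCurve c] := by
    ext x
    simp only [Set.mem_image, Set.mem_insert_iff, Set.mem_singleton_iff, exists_eq_or_imp,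
      exists_eq_left, Set.mem_range, Fin.exists_fin_succ]
    simp
  rw [direction_affineSpan, himage, hind.finrank_vectorSpan (n := 2) (by simp)]

/-! ### The embedded hypergraph and its chromatic number -/

/-- The hypergraph on `{0, …, n - 1}` whose edges are the triples of `E`. -/
def tripleHypergraph {m n : ℕ} {E : ℕ → ℕ → ℕ → Prop} (hE : IsNoncrossing m E) (hmn : m ≤ n) :
    Hypergraph ℕ where
  vertexSet := Set.Iio n
  edgeSet := {e | ∃ a b c, E a b c ∧ e = {a, b, c}}
  subset_vertexSet_of_mem_edgeSet' := by
    rintro e ⟨a, b, c, h, rfl⟩ x hx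
    have := hE.lt₁₂ h
    have := hE.lt₂₃ h
    have := hE.lt h
    simp only [Set.mem_insert_iff, Set.mem_singleton_iff] at hx
    simp only [Set.mem_Iio]
    omega

theorem tripleHypergraph_isUniform {m n : ℕ} {E : ℕ → ℕ → ℕ → Prop} (hE : IsNoncrossing m E)
    (hmn : m ≤ n) : (tripleHypergraph hE hmn).IsUniform 3 := by
  refine ⟨Set.finite_Iio n, ?_⟩
  rintro e ⟨a, b, c, h, rfl⟩
  have := hE.lt₁₂ h
  have := hE.lt₂₃ h
  exact Set.ncard_eq_three.2 ⟨a, b, c, by omega, by omega, by omega, rfl⟩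

theorem IsNoncrossing.not_separated' {m : ℕ} {E : ℕ → ℕ → ℕ → Prop} (hE : IsNoncrossing m E)
    {a b c a' b' c' : ℕ} (h : E a b c) (h' : E a' b' c') :
    ∀ x ∈ ({a, b, c} : Finset ℕ), ∀ y ∈ ({a, b, c} : Finset ℕ), ∀ z ∈ ({a, b, c} : Finset ℕ),
      ∀ p ∈ ({a', b', c'} : Finset ℕ), ∀ q ∈ ({a', b', c'} : Finset ℕ),
        ¬ (x < p ∧ p < y ∧ y < q ∧ q < z) := by
  intro x hx y hy z hz p hp q hq ⟨h₁, h₂, h₃, h₄⟩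
  have hab := hE.lt₁₂ h
  have hbc := hE.lt₂₃ h
  simp only [Finset.mem_insert, Finset.mem_singleton] at hx hy hz hp hq
  exact hE.not_separated h h' p hp q hq ⟨by omega, by omega, by omega, by omega⟩

theorem tripleHypergraph_isEmbedding {m n : ℕ} {E : ℕ → ℕ → ℕ → Prop} (hE : IsNoncrossing m E)
    (hmn : m ≤ n) : (tripleHypergraph hE hmn).IsEmbedding 3 3 momentCurve := by
  constructor
  · rintro e ⟨a, b, c, h, rfl⟩
    exact finrank_direction_affineSpan_momentCurve (hE.lt₁₂ h) (hE.lt₂₃ h)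
  · rintro e₁ ⟨a, b, c, h, rfl⟩ e₂ ⟨a', b', c', h', rfl⟩
    simpa using convexHull_momentCurve_inter (hE.not_separated' h h') (hE.not_separated' h' h)

theorem le_weakChromaticNumber_tripleHypergraph {m n k : ℕ} {E : ℕ → ℕ → ℕ → Prop}
    (hE : IsNoncrossing m E) (hmn : m ≤ n) (hk : ForcesColors m k E) :
    k ≤ (tripleHypergraph hE hmn).weakChromaticNumber := by
  obtain ⟨κ, hκ, hedge⟩ := (Hypergraph.isLeast_weakChromaticNumber (tripleHypergraph hE hmn)
    (by norm_num) (tripleHypergraph_isUniform hE hmn)).1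
  by_contra! hlt
  obtain ⟨a, b, c, h, hab, hbc⟩ := hk (Finset.Icc 1 _) κ (by simpa using hlt)
    fun v hv => Finset.mem_Icc.2 (hκ v (hv.trans_le hmn))
  have := hedge _ ⟨a, b, c, h, rfl⟩
  simp [Set.image_insert_eq, hab, hbc] at this

/-- Isolated vertices pad the construction, so the bound holds for every sufficiently large `n`. -/
theorem le_maxWeakChromaticNumber {k n : ℕ} (h : (2 * k) ^ (2 * k) ≤ n) :
    k ≤ Hypergraph.maxWeakChromaticNumber 3 3 n := by
  obtain ⟨m, hm, E, hE, hk⟩ := exists_isNoncrossing_forcesColors k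
  refine (le_weakChromaticNumber_tripleHypergraph hE (hm.trans h) hk).trans
    ((Hypergraph.isGreatest_maxWeakChromaticNumber 3 (by norm_num) n).2
      ⟨ℕ, _, ⟨tripleHypergraph_isUniform hE (hm.trans h), momentCurve,
        tripleHypergraph_isEmbedding hE (hm.trans h)⟩, ?_, rfl⟩)
  simp [tripleHypergraph]

/-! ### Asymptotics -/

theorem mainTheorem2 :
    ∃ C : ℝ, 0 < C ∧ ∀ᶠ n : ℕ in atTop,
      C * (Real.log (n : ℝ) / Real.log (Real.log (n : ℝ))) ≤
        (Hypergraph.maxWeakChromaticNumber 3 3 n : ℝ) := by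
  refine ⟨1 / 4, by norm_num, ?_⟩
  have hlog : Tendsto (fun n : ℕ => Real.log (n : ℝ)) atTop atTop :=
    Real.tendsto_log_atTop.comp tendsto_natCast_atTop_atTop
  have hloglog := Real.tendsto_log_atTop.comp hlog
  have hsmall : ∀ᶠ n : ℕ in atTop, 4 * Real.log (Real.log (n : ℝ)) ≤ Real.log n := by
    filter_upwards [(Real.isLittleO_log_id_atTop.comp_tendsto hlog).bound
      (show (0 : ℝ) < 1 / 4 by norm_num), hlog.eventually_ge_atTop 0] with n hn hn₀
    simp only [Function.comp, id, Real.norm_eq_abs] at hn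
    rw [abs_of_nonneg hn₀] at hn
    linarith [le_abs_self (Real.log (Real.log (n : ℝ)))]
  filter_upwards [hsmall, hloglog.eventually_ge_atTop 1, hlog.eventually_gt_atTop 0,
    eventually_gt_atTop 0] with n hn hll hl hn₀
  simp only [Function.comp] at hll
  set L := Real.log (n : ℝ) with hL
  set M := Real.log L with hM
  have hMpos : 0 < M := by linarith
  have hx : 2 ≤ L / (2 * M) := by
    rw [le_div_iff₀ (by positivity)]
    linarith
  -- Since `L / (2 * M) ≥ 2`, rounding down loses at most half, so `k ≥ L / (4 * M)`; this is the
  -- constant `1 / 4`.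
  set k := ⌊L / (2 * M)⌋₊ with hk
  have hk₁ : (k : ℝ) ≤ L / (2 * M) := Nat.floor_le (by positivity)
  have hk₂ : L / (2 * M) < k + 1 := Nat.lt_floor_add_one _
  have hquot : L / M = 2 * (L / (2 * M)) := by
    field_simp
  have hkpos : (0 : ℝ) < k := by linarith
  -- From `2kM ≤ L` and `M ≥ 1` follows `2k ≤ L`, so `log (2k) ≤ M` and `2k log (2k) ≤ 2kM ≤ L`.
  have hpow : (2 * k) ^ (2 * k) ≤ n := by
    have h2k : 2 * (k : ℝ) * M ≤ L := by
      rw [le_div_iff₀ (by positivity)] at hk₁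
      linarith
    have hle : 2 * (k : ℝ) ≤ L := le_trans (le_mul_of_one_le_right (by positivity) hll) h2k
    have : Real.log ((2 * (k : ℝ)) ^ (2 * k)) ≤ Real.log n := by
      rw [Real.log_pow, ← hL]
      push_cast
      exact (mul_le_mul_of_nonneg_left (Real.log_le_log (by positivity) hle)
        (by positivity)).trans h2k
    have := (Real.log_le_log_iff (by positivity) (by exact_mod_cast hn₀)).1 this
    exact_mod_cast this
  have hmax : (k : ℝ) ≤ Hypergraph.maxWeakChromaticNumber 3 3 n := by
    exact_mod_cast le_maxWeakChromaticNumber hpow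
  rw [hquot]
  linarith
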